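/- Let $R$ be a noetherian commutative ring and let $\mathcal T$ be an $R$-linear triangulated category with shift functor $\Sigma$; $R$-linear means that the Hom-sets are $R$-modules and that composition is $R$-bilinear. For an object $G$ of a triangulated category, let $\langle G\rangle_1$ be the full subcategory of all direct summands of finite coproducts of objects $\Sigma^iG$ ($i\in\mathbb Z$), and, for $n\ge 1$, let $\langle G\rangle_{n+1}$ be the full subcategory of all direct summands of objects $y$ that admit a distinguished triangle $x\to y\to z\to\Sigma x$ with $x\in\langle G\rangle_1$ and $z\in\langle G\rangle_n$. A triangulated category is called regular if for some object $G$ and some $n\ge 1$ it equals $\langle G\rangle_n$, and Karoubian if all of its idempotents split. An $R$-linear triangulated category is called proper over $R$ if for every pair of its objects $X,Y$ the direct sum $\bigoplus_{i\in\mathbb Z}\mathrm{Hom}(X,\Sigma^iY)$ is a finite $R$-module. Assume that $\mathcal T$ is regular, Karoubian and proper over $R$, and let $\mathcal S\subset\mathcal T$ be a full triangulated subcategory. If the inclusion functor $I:\mathcal S\to\mathcal T$ has a left adjoint or a right adjoint, then it has both a left adjoint and a right adjoint. Moreover, in that case $\mathcal S$ is itself Karoubian, regular and proper over $R$. -/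

import Mathlib

open CategoryTheory Limits Pretriangulated
open scoped DirectSum

/-- A triangulated category is *regular* if it has a strong generator: an object `G` such that,
for some `n`, every object lies in `⟨G⟩_{n+1}`. Here `⟨G⟩_{n+1}` is Mathlib's
`(ObjectProperty.singleton G).triangEnvelopeIter n`: for `n = 0` it consists of the direct summands
of finite coproducts of shifts of `G` (`triangEnvelopeIter_zero`), and `⟨G⟩_{n+2}` consists of the
direct summands of objects `y` in a distinguished triangle `x ⟶ y ⟶ z ⟶ x⟦1⟧` with `x` in
`⟨G⟩_1` and `z` in `⟨G⟩_{n+1}` (`triangEnvelopeIter_succ`). -/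
def IsRegularTriangulated (T : Type*) [Category* T] [HasZeroObject T] [HasShift T ℤ]
    [Preadditive T] [∀ n : ℤ, (shiftFunctor T n).Additive] [Pretriangulated T] : Prop :=
  ∃ G : T, (ObjectProperty.singleton G).IsStrongTriangulatedGenerator

/-- An `R`-linear category with shift is *proper* over `R` if, for all objects `X` and `Y`, the
direct sum over all integers `i` of the modules of morphisms `X ⟶ Y⟦i⟧` is a finite
`R`-module. -/
def IsProperOver (R : Type*) [CommRing R] (T : Type*) [Category* T] [HasShift T ℤ]
    [Preadditive T] [Linear R T] : Prop :=
  ∀ X Y : T, Module.Finite R (⨁ i : ℤ, (X ⟶ (shiftFunctor T i).obj Y))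

/-! An adjoint of the fully faithful inclusion is triangulated and essentially surjective, so it
carries a strong generator to a strong generator and splittings of idempotents to splittings.
Properness passes to Hom-modules of the subcategory. Hence `S` is regular, Karoubian and proper, and
both adjoints come from a representability theorem for linear triangulated functors `F : C ⥤ D` with
`C` regular and Karoubian.

For `t : D`, the functor `Hom(F -, t)` must be represented. Finiteness gives `a : F.obj A ⟶ t`
through which all morphisms from shifts of `G` factor. Repeatedly coning off the kernel of `Hom(-,
A) → Hom(F -, t)` on shifts of `G` extends this to all objects, and yields `g : A ⟶ A'` annihilating
the whole kernel (`exists_triangEnvelopeIter_le_kills_lifts`). A representing object then splits off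
`A'` (`exists_bijective_of_kills_lifts`). The other adjoint follows by passing to opposite
categories. -/

namespace CategoryTheory

/-! ### Level zero of the generation filtration -/

section Generation

variable {C : Type*} [Category* C] [HasZeroObject C] [HasShift C ℤ] [Preadditive C]
  [∀ n : ℤ, (shiftFunctor C n).Additive] [Pretriangulated C]

namespace ObjectProperty

lemma isClosedUnderBinaryProducts_of_biprod (Q : ObjectProperty C) [Q.IsClosedUnderIsomorphisms]
    (h : ∀ X Y, Q X → Q Y → Q (X ⊞ Y)) : Q.IsClosedUnderBinaryProducts where
  limitsOfShape_le := by
    rintro X ⟨p⟩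
    refine Q.prop_of_iso ?_ (h _ _ (p.prop_diag_obj (.mk .left)) (p.prop_diag_obj (.mk .right)))
    exact IsLimit.conePointUniqueUpToIso (BinaryBiproduct.isLimit _ _)
      ((IsLimit.postcomposeHomEquiv (diagramIsoPair p.diag) _).2 p.isLimit)

lemma singleton_triangEnvelopeIter_zero_le {G : C} {Q : ObjectProperty C}
    [Q.IsStableUnderRetracts] (hG : ∀ i : ℤ, Q (G⟦i⟧))
    (h : ∀ X Y, Q X → Q Y → Q (X ⊞ Y)) :
    (singleton G).triangEnvelopeIter 0 ≤ Q := by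
  have := Q.isClosedUnderBinaryProducts_of_biprod h
  have : Q.Nonempty := ⟨_, hG 0⟩
  rw [triangEnvelopeIter_zero, retractClosure_le_iff, binaryProductsClosure_le_iff]
  rintro X ⟨Y, i, e, hY⟩
  obtain rfl : G = Y := by simpa using hY
  exact Q.prop_of_iso e.symm (hG i)

lemma triangEnvelopeIter_biprod (P : ObjectProperty C) {X Y : C}
    (hX : P.triangEnvelopeIter 0 X) (hY : P.triangEnvelopeIter 0 Y) :
    P.triangEnvelopeIter 0 (X ⊞ Y) := by
  rw [triangEnvelopeIter_zero] at hX hY ⊢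
  obtain ⟨X', hX', ⟨r⟩⟩ := hX
  obtain ⟨Y', hY', ⟨s⟩⟩ := hY
  refine ⟨X' ⊞ Y', ?_, ⟨⟨biprod.map r.i s.i, biprod.map r.r s.r, ?_⟩⟩⟩
  · exact P.shiftClosure ℤ |>.binaryProductsClosure.prop_of_isLimit_binaryFan
      (BinaryBiproduct.isLimit X' Y') hX' hY'
  · ext <;> simp

lemma singleton_triangEnvelopeIter_zero_shift (G : C) (i : ℤ) :
    (singleton G).triangEnvelopeIter 0 (G⟦i⟧) :=
  IsStableUnderShiftBy.le_shift _ ((singleton G).le_triangEnvelopeIter 0 _ (by simp))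

end ObjectProperty

end Generation

/-! ### Transport of generators and splittings along functors -/

section Functor

variable {C D : Type*} [Category* C] [Category* D] [HasZeroObject C] [HasZeroObject D]
  [HasShift C ℤ] [HasShift D ℤ] [Preadditive C] [Preadditive D]
  [∀ n : ℤ, (shiftFunctor C n).Additive] [∀ n : ℤ, (shiftFunctor D n).Additive]
  [Pretriangulated C] [Pretriangulated D]

instance ObjectProperty.isStableUnderRetracts_inverseImage (Q : ObjectProperty D)
    [Q.IsStableUnderRetracts] (F : C ⥤ D) : (Q.inverseImage F).IsStableUnderRetracts where
  of_retract r h := Q.prop_of_retract (r.map F) h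

lemma Functor.triangEnvelopeIter_le_inverseImage (F : C ⥤ D) [F.CommShift ℤ] [F.IsTriangulated]
    (G : C) (n : ℕ) :
    (ObjectProperty.singleton G).triangEnvelopeIter n ≤
      ((ObjectProperty.singleton (F.obj G)).triangEnvelopeIter n).inverseImage F := by
  have h₀ : (ObjectProperty.singleton G).triangEnvelopeIter 0 ≤
      ((ObjectProperty.singleton (F.obj G)).triangEnvelopeIter 0).inverseImage F :=
    ObjectProperty.singleton_triangEnvelopeIter_zero_le
      (fun i => (ObjectProperty.prop_iff_of_iso _ ((F.commShiftIso i).app G)).2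
        (ObjectProperty.singleton_triangEnvelopeIter_zero_shift (F.obj G) i))
      (fun X Y hX hY => by
        have := preservesBinaryBiproducts_of_preservesBiproducts F
        exact (ObjectProperty.prop_iff_of_iso _ (F.mapBiprod X Y)).2
          (ObjectProperty.triangEnvelopeIter_biprod _ hX hY))
  induction n with
  | zero => exact h₀
  | succ n ih =>
    rw [ObjectProperty.triangEnvelopeIter_succ, ObjectProperty.triangEnvelopeIter_succ,
      ObjectProperty.retractClosure_le_iff, ← ObjectProperty.triangEnvelopeIter_zero,
      ← ObjectProperty.triangEnvelopeIter_zero]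
    rintro X ⟨Y, Z, f, g, k, hT, hY, hZ⟩
    exact ObjectProperty.le_retractClosure _ _
      ⟨_, _, _, _, _, F.map_distinguished _ hT, h₀ _ hY, ih _ hZ⟩

lemma _root_.IsRegularTriangulated.of_essSurj (F : C ⥤ D) [F.CommShift ℤ] [F.IsTriangulated]
    [F.EssSurj] (h : IsRegularTriangulated C) : IsRegularTriangulated D := by
  obtain ⟨G, n, hn⟩ := h
  refine ⟨F.obj G, n, top_le_iff.1 fun Y _ => ?_⟩
  exact ObjectProperty.prop_of_iso _ (F.objObjPreimageIso Y)
    (F.triangEnvelopeIter_le_inverseImage G n _ (by rw [hn]; trivial))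

lemma isIdempotentComplete_of_comp_iso_id {A B : Type*} [Category* A] [Category* B]
    {I : A ⥤ B} {F : B ⥤ A}
    (e : I ⋙ F ≅ 𝟭 A) (h : IsIdempotentComplete B) : IsIdempotentComplete A where
  idempotents_split X p hp := by
    obtain ⟨Y, i, q, h₁, h₂⟩ := h.idempotents_split (I.obj X) (I.map p)
      (by rw [← I.map_comp, hp])
    refine ⟨F.obj Y, F.map i ≫ e.hom.app X, e.inv.app X ≫ F.map q, ?_, ?_⟩
    · simp [← F.map_comp, h₁]
    · have := e.hom.naturality p
      simp only [Functor.comp_map, ← h₂, F.map_comp, Category.assoc] at this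
      simp [this]

end Functor

/-! ### Regularity of the opposite category -/

section Opposite

open Pretriangulated.Opposite Opposite

variable {C : Type*} [Category* C] [HasZeroObject C] [HasShift C ℤ] [Preadditive C]
  [∀ n : ℤ, (shiftFunctor C n).Additive] [Pretriangulated C]

instance ObjectProperty.isStableUnderRetracts_unop (Q : ObjectProperty Cᵒᵖ)
    [Q.IsStableUnderRetracts] : Q.unop.IsStableUnderRetracts where
  of_retract r h := Q.prop_of_retract ⟨r.r.op, r.i.op, by simp [← op_comp]⟩ h

lemma ObjectProperty.triangEnvelopeIter_le_unop [IsTriangulated C] (G : C) (n : ℕ) :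
    (singleton G).triangEnvelopeIter n ≤ ((singleton (op G)).triangEnvelopeIter n).unop := by
  have h₀ : (singleton G).triangEnvelopeIter 0 ≤
      ((singleton (op G)).triangEnvelopeIter 0).unop := by
    refine singleton_triangEnvelopeIter_zero_le (fun i => ?_) (fun X Y hX hY => ?_)
    · exact (prop_iff_of_iso _ ((shiftFunctorOpIso C (-i) i (by simp)).app (op G))).1
        (singleton_triangEnvelopeIter_zero_shift (op G) (-i))
    · exact (prop_iff_of_iso _ (IsLimit.conePointUniqueUpToIso
        (BinaryBiproduct.isLimit (op X) (op Y)) (BinaryBiproduct.isBilimit X Y).op.isLimit)).1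
        (triangEnvelopeIter_biprod _ hX hY)
  induction n with
  | zero => exact h₀
  | succ n ih =>
    -- Passing to opposites reverses triangles, so on one side the level-zero object must be the
    -- third vertex.
    rw [triangEnvelopeIter_succ', triangEnvelopeIter_succ, retractClosure_le_iff,
      ← triangEnvelopeIter_zero, ← triangEnvelopeIter_zero]
    rintro X ⟨Y, Z, f, g, k, hT, hY, hZ⟩
    exact le_retractClosure _ _ ⟨_, _, _, _, _, op_distinguished _ hT, h₀ _ hZ, ih _ hY⟩

lemma _root_.IsRegularTriangulated.op [IsTriangulated C] (h : IsRegularTriangulated C) :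
    IsRegularTriangulated Cᵒᵖ := by
  obtain ⟨G, n, hn⟩ := h
  refine ⟨Opposite.op G, n, top_le_iff.1 fun Y _ => ?_⟩
  exact ObjectProperty.triangEnvelopeIter_le_unop G n Y.unop (by rw [hn]; trivial)

end Opposite

/-! ### Finiteness of Hom-modules -/

section HomFinite

variable (R : Type*) [CommRing R]

/-- All morphism modules are finite, and for fixed objects `X` and `Y`, all but finitely many of
the modules `X⟦i⟧ ⟶ Y` vanish. -/
structure IsHomFinite (C : Type*) [Category* C] [HasShift C ℤ] [Preadditive C] [Linear R C] :
    Prop where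
  finite (X Y : C) : Module.Finite R (X ⟶ Y)
  finite_support (X Y : C) : {i : ℤ | Nontrivial (X⟦i⟧ ⟶ Y)}.Finite

lemma nontrivial_shift_hom_iff {C : Type*} [Category* C] [HasShift C ℤ] (X Y : C) (i j : ℤ)
    (h : i + j = 0) : Nontrivial (X⟦i⟧ ⟶ Y) ↔ Nontrivial (X ⟶ Y⟦j⟧) :=
  ((shiftEquiv' C i j h).toAdjunction.homEquiv X Y).nontrivial_congr

/-- Finitely many generators have only finitely many nonzero components; projection to any other
summand vanishes on them, hence everywhere. -/
lemma finite_setOf_nontrivial_of_directSum {ι : Type*} [DecidableEq ι] (M : ι → Type*)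
    [∀ i, AddCommGroup (M i)] [∀ i, Module R (M i)] [Module.Finite R (⨁ i, M i)] :
    {i | Nontrivial (M i)}.Finite := by
  classical
  obtain ⟨s, hs⟩ := Module.Finite.fg_top (R := R) (M := ⨁ i, M i)
  refine (s.biUnion fun x => DFinsupp.support x).finite_toSet.subset fun i hi => ?_
  by_contra hi'
  have hker : (⊤ : Submodule R (⨁ i, M i)) ≤ LinearMap.ker (DirectSum.component R ι M i) := by
    rw [← hs, Submodule.span_le]
    intro x hx
    by_contra hne
    exact hi' (Finset.mem_coe.2 (Finset.mem_biUnion.2 ⟨x, hx, DFinsupp.mem_support_iff.2 hne⟩))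
  obtain ⟨m, hm⟩ := @exists_ne _ hi 0
  apply hm
  simpa [DirectSum.component.lof_self] using! hker (x := DirectSum.lof R ι M i m) trivial

variable {R} in
lemma _root_.IsProperOver.isHomFinite {C : Type*} [Category* C] [HasShift C ℤ] [Preadditive C]
    [Linear R C] (h : IsProperOver R C) : IsHomFinite R C where
  finite X Y := by
    have := h X Y
    have : Module.Finite R (X ⟶ Y⟦(0 : ℤ)⟧) :=
      Module.Finite.of_surjective (DirectSum.component R ℤ (fun i : ℤ => X ⟶ Y⟦i⟧) 0)
        (fun f => ⟨DirectSum.lof R ℤ _ 0 f, DirectSum.component.lof_self _ _ _⟩)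
    exact Module.Finite.equiv (Linear.homCongr R (Iso.refl X) ((shiftFunctorZero C ℤ).app Y))
  finite_support X Y := by
    have := h X Y
    refine ((finite_setOf_nontrivial_of_directSum R (fun i : ℤ => X ⟶ Y⟦i⟧)).image
      (fun i => -i)).subset fun i hi => ⟨-i, ?_, neg_neg i⟩
    exact (nontrivial_shift_hom_iff X Y i (-i) (by simp)).1 hi

variable {R} in
lemma _root_.IsProperOver.of_fullyFaithful {C D : Type*} [Category* C] [Category* D]
    [HasShift C ℤ] [HasShift D ℤ] [Preadditive C] [Preadditive D] [Linear R C] [Linear R D]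
    (F : C ⥤ D) [F.CommShift ℤ] [F.Additive] [F.Linear R] [F.Full] [F.Faithful]
    (h : IsProperOver R D) : IsProperOver R C := fun X Y => by
  have := h (F.obj X) (F.obj Y)
  let e (i : ℤ) : (X ⟶ Y⟦i⟧) ≃ₗ[R] (F.obj X ⟶ (F.obj Y)⟦i⟧) :=
    (LinearEquiv.ofBijective (F.mapLinearMap R)
      ((Functor.FullyFaithful.ofFullyFaithful F).map_bijective X (Y⟦i⟧))).trans
      (Linear.homCongr R (Iso.refl _) ((F.commShiftIso i).app Y))
  have e' : (⨁ i : ℤ, (X ⟶ Y⟦i⟧)) ≃ₗ[R] (⨁ i : ℤ, (F.obj X ⟶ (F.obj Y)⟦i⟧)) :=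
    DFinsupp.mapRange.linearEquiv e
  exact Module.Finite.equiv e'.symm

/-- The opposite of an `R`-linear category is `R`-linear. -/
instance linearOpposite (C : Type*) [Category* C] [Preadditive C] [Linear R C] :
    Linear R Cᵒᵖ where
  homModule _ _ :=
    { smul := fun r f => (r • f.unop).op
      one_smul := fun f => Quiver.Hom.unop_inj (one_smul R f.unop)
      mul_smul := fun r s f => Quiver.Hom.unop_inj (mul_smul r s f.unop)
      smul_zero := fun r => Quiver.Hom.unop_inj (smul_zero r)
      smul_add := fun r f g => Quiver.Hom.unop_inj (smul_add r f.unop g.unop)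
      add_smul := fun r s f => Quiver.Hom.unop_inj (add_smul r s f.unop)
      zero_smul := fun f => Quiver.Hom.unop_inj (zero_smul R f.unop) }
  smul_comp _ _ _ r f g := Quiver.Hom.unop_inj (Linear.comp_smul _ _ _ g.unop r f.unop)
  comp_smul _ _ _ f r g := Quiver.Hom.unop_inj (Linear.smul_comp _ _ _ r g.unop f.unop)

instance linear_op {C D : Type*} [Category* C] [Category* D] [Preadditive C] [Preadditive D]
    [Linear R C] [Linear R D] (F : C ⥤ D) [F.Linear R] : F.op.Linear R where
  map_smul f r := Quiver.Hom.unop_inj (F.map_smul r f.unop)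

open Pretriangulated.Opposite in
variable {R} in
lemma IsHomFinite.op {C : Type*} [Category* C] [HasShift C ℤ] [Preadditive C] [Linear R C]
    (h : IsHomFinite R C) : IsHomFinite R Cᵒᵖ where
  finite X Y := by
    have := h.finite Y.unop X.unop
    let e : (Y.unop ⟶ X.unop) →ₗ[R] (X ⟶ Y) :=
      { toFun := fun f => f.op
        map_add' := fun _ _ => rfl
        map_smul' := fun _ _ => rfl }
    exact Module.Finite.of_surjective e (fun f => ⟨f.unop, rfl⟩)
  finite_support X Y := by
    refine (h.finite_support Y.unop X.unop).subset fun i (hi : Nontrivial (X⟦i⟧ ⟶ Y)) => ?_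
    have e : X⟦i⟧ ≅ Opposite.op (X.unop⟦-i⟧) := (shiftFunctorOpIso C i (-i) (by simp)).app X
    have : Nontrivial (Y.unop ⟶ X.unop⟦-i⟧) :=
      ((e.homCongr (Iso.refl Y)).trans (opEquiv _ _)).nontrivial_congr.1 hi
    exact (nontrivial_shift_hom_iff Y.unop X.unop i (-i) (by simp)).2 this

end HomFinite

/-! ### Approximation by finite coproducts -/

section Approximation

variable {R : Type*} [CommRing R] {C D : Type*} [Category* C] [Category* D] [Preadditive C]
  [Preadditive D] [Linear R C] [Linear R D] [HasFiniteBiproducts C] (F : C ⥤ D) [F.Additive]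
  [F.Linear R]

/-- Finitely many morphisms `a i` to `t` factor through a single one, which is a sum of morphisms
factoring through the `a i`. -/
lemma exists_factorization_of_finite {ι : Type*} [Finite ι] (A : ι → C) {t : D}
    (a : ∀ i, F.obj (A i) ⟶ t) :
    ∃ (B : C) (b : F.obj B ⟶ t) (φ : ∀ i, A i ⟶ B), (∀ i, F.map (φ i) ≫ b = a i) ∧
      ∀ S : AddSubgroup (F.obj B ⟶ t), (∀ (i) (ψ : B ⟶ A i), F.map ψ ≫ a i ∈ S) → b ∈ S := by
  classical
  have := Fintype.ofFinite ι
  refine ⟨biproduct A, ∑ i, F.map (biproduct.π A i) ≫ a i, fun i => biproduct.ι A i, fun i => ?_,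
    fun S h => sum_mem fun i _ => h i _⟩
  rw [Preadditive.comp_sum, Finset.sum_eq_single i]
  · rw [← F.map_comp_assoc, biproduct.ι_π_self]
    simp
  · intro j _ hj
    rw [← F.map_comp_assoc, biproduct.ι_π_ne _ hj.symm]
    simp
  · simp

/-- The morphisms in a finitely generated submodule factor through a single one, which is a sum of
morphisms factoring through elements of the submodule. -/
lemma exists_factorization_of_fg {X : C} {t : D} (N : Submodule R (F.obj X ⟶ t)) (hN : N.FG) :
    ∃ (B : C) (b : F.obj B ⟶ t), (∀ n ∈ N, ∃ φ : X ⟶ B, F.map φ ≫ b = n) ∧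
      ∀ S : AddSubgroup (F.obj B ⟶ t), (∀ n ∈ N, ∀ ψ : B ⟶ X, F.map ψ ≫ n ∈ S) → b ∈ S := by
  obtain ⟨s, rfl⟩ := hN
  obtain ⟨B, b, φ, hφ, hb⟩ := exists_factorization_of_finite F (fun _ : s => X)
    (fun n : s => (n : F.obj X ⟶ t))
  refine ⟨B, b, fun n hn => ?_, fun S h => hb S fun n => h _ (Submodule.subset_span n.2)⟩
  induction hn using Submodule.span_induction with
  | mem x hx => exact ⟨φ ⟨x, hx⟩, hφ ⟨x, hx⟩⟩
  | zero => exact ⟨0, by simp⟩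
  | add x y _ _ hx hy =>
    obtain ⟨f, rfl⟩ := hx
    obtain ⟨g, rfl⟩ := hy
    exact ⟨f + g, by simp⟩
  | smul r x _ hx =>
    obtain ⟨f, rfl⟩ := hx
    exact ⟨r • f, by simp⟩

/-- Only finitely many indices carry nonzero morphisms to `t`, so a finite biproduct suffices. The
clause on `S` lets `b` inherit additive conditions, such as lying in a kernel. -/
lemma exists_factorization_of_family {ι : Type*} (X : ι → C) {t : D}
    (N : ∀ i, Submodule R (F.obj (X i) ⟶ t)) (hN : ∀ i, (N i).FG)
    (hfin : {i | Nontrivial (F.obj (X i) ⟶ t)}.Finite) :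
    ∃ (B : C) (b : F.obj B ⟶ t), (∀ i, ∀ n ∈ N i, ∃ φ : X i ⟶ B, F.map φ ≫ b = n) ∧
      ∀ S : AddSubgroup (F.obj B ⟶ t),
        (∀ i, ∀ n ∈ N i, ∀ ψ : B ⟶ X i, F.map ψ ≫ n ∈ S) → b ∈ S := by
  choose A a h₁ h₂ using fun i => exists_factorization_of_fg F (N i) (hN i)
  have : Finite {i | Nontrivial (F.obj (X i) ⟶ t)} := hfin
  obtain ⟨B, b, φ, hφ, hb⟩ := exists_factorization_of_finite F
    (fun i : {i | Nontrivial (F.obj (X i) ⟶ t)} => A i) (fun i => a i)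
  refine ⟨B, b, fun i n hn => ?_, fun S h => hb S fun i ψ => ?_⟩
  · by_cases hi : Nontrivial (F.obj (X i) ⟶ t)
    · obtain ⟨ψ, hψ⟩ := h₁ i n hn
      exact ⟨ψ ≫ φ ⟨i, hi⟩, by rw [F.map_comp, Category.assoc, hφ ⟨i, hi⟩, hψ]⟩
    · rw [not_nontrivial_iff_subsingleton] at hi
      exact ⟨0, Subsingleton.elim _ _⟩
  · exact h₂ i (S.comap (Preadditive.leftComp t (F.map ψ))) fun n hn ψ' => by
      change F.map ψ ≫ F.map ψ' ≫ n ∈ S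
      rw [← F.map_comp_assoc]
      exact h i n hn (ψ ≫ ψ')

end Approximation

/-! ### Lifting and annihilation conditions -/

section LiftsKills

variable {C D : Type*} [Category* C] [Category* D] (F : C ⥤ D)

/-- The objects `X` such that every morphism `F.obj X ⟶ t` factors as `F.map α ≫ a`. -/
def Functor.lifts {A : C} {t : D} (a : F.obj A ⟶ t) : ObjectProperty C :=
  fun X => ∀ x : F.obj X ⟶ t, ∃ α : X ⟶ A, F.map α ≫ a = x

variable {F}

instance {A : C} {t : D} (a : F.obj A ⟶ t) : (F.lifts a).IsStableUnderRetracts where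
  of_retract r h x := by
    obtain ⟨α, hα⟩ := h (F.map r.r ≫ x)
    exact ⟨r.i ≫ α, by simp [hα, ← F.map_comp_assoc]⟩

lemma Functor.lifts_le_lifts {A A' : C} {t : D} {a : F.obj A ⟶ t} {a' : F.obj A' ⟶ t}
    (g : A ⟶ A') (hg : F.map g ≫ a' = a) : F.lifts a ≤ F.lifts a' := fun X h x => by
  obtain ⟨α, hα⟩ := h x
  exact ⟨α ≫ g, by simp [hg, hα]⟩

variable [Preadditive C] [Preadditive D]

variable (F) in
/-- The objects `X` such that every morphism `α : X ⟶ A` with `F.map α ≫ a = 0` is annihilated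
by postcomposition with `g`. -/
def Functor.kills {A A' : C} {t : D} (a : F.obj A ⟶ t) (g : A ⟶ A') : ObjectProperty C :=
  fun X => ∀ α : X ⟶ A, F.map α ≫ a = 0 → α ≫ g = 0

instance {A A' : C} {t : D} (a : F.obj A ⟶ t) (g : A ⟶ A') :
    (F.kills a g).IsStableUnderRetracts where
  of_retract r h α hα := by
    have := h (r.r ≫ α) (by simp [hα])
    simpa using r.i ≫= this

variable [HasBinaryBiproducts C]

lemma Functor.lifts_biprod [F.Additive] {A : C} {t : D} {a : F.obj A ⟶ t} {X Y : C}
    (hX : F.lifts a X) (hY : F.lifts a Y) : F.lifts a (X ⊞ Y) := fun x => by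
  obtain ⟨α, hα⟩ := hX (F.map biprod.inl ≫ x)
  obtain ⟨β, hβ⟩ := hY (F.map biprod.inr ≫ x)
  refine ⟨biprod.fst ≫ α + biprod.snd ≫ β, ?_⟩
  simp only [F.map_add, F.map_comp, Preadditive.add_comp, Category.assoc, hα, hβ]
  simp only [← F.map_comp_assoc, ← Preadditive.add_comp, ← F.map_add, biprod.total, F.map_id,
    Category.id_comp]

lemma Functor.kills_biprod {A A' : C} {t : D} {a : F.obj A ⟶ t} {g : A ⟶ A'} {X Y : C}
    (hX : F.kills a g X) (hY : F.kills a g Y) : F.kills a g (X ⊞ Y) := fun α hα => by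
  ext
  · simpa using hX (biprod.inl ≫ α) (by simp [hα])
  · simpa using hY (biprod.inr ≫ α) (by simp [hα])

end LiftsKills

/-! ### Representability of `Hom(F -, t)` -/

section Representability

variable {C D : Type*} [Category* C] [Category* D] [HasZeroObject C] [HasZeroObject D]
  [HasShift C ℤ] [HasShift D ℤ] [Preadditive C] [Preadditive D]
  [∀ n : ℤ, (shiftFunctor C n).Additive] [∀ n : ℤ, (shiftFunctor D n).Additive]
  [Pretriangulated C] [Pretriangulated D] {F : C ⥤ D}

section Exactness

variable {X Y Z : C} {u : Y ⟶ X} {v : X ⟶ Z} {w : Z ⟶ Y⟦(1 : ℤ)⟧}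

lemma exists_comp_eq_of_distTriang (hT : Triangle.mk u v w ∈ distTriang C) {W : C} (x : X ⟶ W)
    (hx : u ≫ x = 0) : ∃ z : Z ⟶ W, v ≫ z = x := by
  obtain ⟨z, hz⟩ := Triangle.yoneda_exact₂ _ hT x hx
  exact ⟨z, hz.symm⟩

lemma exists_weakCokernel_of_distTriang (hT : Triangle.mk u v w ∈ distTriang C) :
    ∃ p : Z⟦(-1 : ℤ)⟧ ⟶ Y, p ≫ u = 0 ∧
      ∀ ⦃W : C⦄ (y : Y ⟶ W), p ≫ y = 0 → ∃ x : X ⟶ W, u ≫ x = y := by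
  have hT' := inv_rot_of_distTriang _ hT
  refine ⟨(Triangle.mk u v w).invRotate.mor₁, comp_distTriang_mor_zero₁₂ _ hT',
    fun W y hy => ?_⟩
  obtain ⟨x, hx⟩ := Triangle.yoneda_exact₂ _ hT' y hy
  exact ⟨x, hx.symm⟩

variable [F.CommShift ℤ] [F.IsTriangulated] {t : D}

lemma Functor.exists_map_comp_eq₂ (hT : Triangle.mk u v w ∈ distTriang C) (x : F.obj X ⟶ t)
    (hx : F.map u ≫ x = 0) : ∃ z : F.obj Z ⟶ t, F.map v ≫ z = x := by
  obtain ⟨z, hz⟩ := Triangle.yoneda_exact₂ _ (F.map_distinguished _ hT) x hx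
  exact ⟨z, hz.symm⟩

lemma Functor.exists_map_comp_eq₃ (hT : Triangle.mk u v w ∈ distTriang C) (z : F.obj Z ⟶ t)
    (hz : F.map v ≫ z = 0) : ∃ y : F.obj (Y⟦(1 : ℤ)⟧) ⟶ t, F.map w ≫ y = z := by
  obtain ⟨y, hy⟩ := Triangle.yoneda_exact₃ _ (F.map_distinguished _ hT) z hz
  exact ⟨(F.commShiftIso (1 : ℤ)).hom.app Y ≫ y, (Category.assoc _ _ _).symm.trans hy.symm⟩

end Exactness

variable [F.CommShift ℤ] [F.IsTriangulated]

/-- A lift over `Y` extends to `X` once its obstruction on `Z⟦-1⟧` is annihilated by `g`; the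
remaining error factors through `F.obj Z` and is lifted there. -/
lemma Functor.extensionProduct_le_lifts {A A' : C} {t : D} {a : F.obj A ⟶ t}
    {a' : F.obj A' ⟶ t} {g : A ⟶ A'} (hg : F.map g ≫ a' = a) {P Q : ObjectProperty C}
    [Q.IsStableUnderShift ℤ] (hP : P ≤ F.lifts a) (hQ : Q ≤ F.kills a g)
    (hQ' : Q ≤ F.lifts a') : P.extensionProduct Q ≤ F.lifts a' := by
  rintro X ⟨Y, Z, u, v, w, hT, hY, hZ⟩ x
  obtain ⟨η, hη⟩ := hP _ hY (F.map u ≫ x)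
  obtain ⟨p, hp, hp'⟩ := exists_weakCokernel_of_distTriang hT
  have hη' : (p ≫ η) ≫ g = 0 := by
    refine hQ _ (Q.le_shift (-1) _ hZ) (p ≫ η) ?_
    rw [F.map_comp, Category.assoc, hη, ← F.map_comp_assoc, hp, F.map_zero, zero_comp]
  obtain ⟨ζ, hζ⟩ := hp' (η ≫ g) (by simpa using hη')
  obtain ⟨θ, hθ⟩ := F.exists_map_comp_eq₂ hT (x - F.map ζ ≫ a') (by
    rw [Preadditive.comp_sub, ← F.map_comp_assoc, hζ, F.map_comp_assoc, hg, hη, sub_self])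
  obtain ⟨β, hβ⟩ := hQ' _ hZ θ
  refine ⟨ζ + v ≫ β, ?_⟩
  rw [F.map_add, F.map_comp, Preadditive.add_comp, Category.assoc, hβ, hθ]
  abel

/-- After `f`, `α` factors through `v` as `β`. Correcting `β` by a morphism through `w` puts it in
the kernel without changing `v ≫ β`, and then `g` annihilates it. -/
lemma Functor.extensionProduct_le_kills {A₀ A A' : C} {t : D} {a₀ : F.obj A₀ ⟶ t}
    {a : F.obj A ⟶ t} {f : A₀ ⟶ A} (hf : F.map f ≫ a = a₀) {g : A ⟶ A'}
    {P Q : ObjectProperty C} [P.IsStableUnderShift ℤ] (hP : P ≤ F.kills a₀ f)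
    (hP' : P ≤ F.lifts a) (hQ : Q ≤ F.kills a g) :
    P.extensionProduct Q ≤ F.kills a₀ (f ≫ g) := by
  rintro X ⟨Y, Z, u, v, w, hT, hY, hZ⟩ α hα
  obtain ⟨β, hβ⟩ := exists_comp_eq_of_distTriang hT (α ≫ f) (by
    simpa using hP _ hY (u ≫ α) (by simp [hα]))
  obtain ⟨γ, hγ⟩ := F.exists_map_comp_eq₃ hT (F.map β ≫ a) (by
    rw [← F.map_comp_assoc, hβ, F.map_comp_assoc, hf, hα])
  obtain ⟨δ, hδ⟩ := hP' _ (P.le_shift (1 : ℤ) _ hY) γ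
  have h := hQ _ hZ (β - w ≫ δ) (by
    rw [F.map_sub, Preadditive.sub_comp, F.map_comp, Category.assoc, hδ, hγ, sub_self])
  have hvw : v ≫ w = 0 := comp_distTriang_mor_zero₂₃ _ hT
  rw [Preadditive.sub_comp, sub_eq_zero] at h
  rw [← Category.assoc, ← hβ, Category.assoc, h, Category.assoc, reassoc_of% hvw, zero_comp]

variable {G : C} {t : D}

lemma Functor.exists_triangEnvelopeIter_le_kills_lifts
    (hker : ∀ (A : C) (a : F.obj A ⟶ t), ∃ (B : C) (b : B ⟶ A), F.map b ≫ a = 0 ∧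
      ∀ (i : ℤ) (α : G⟦i⟧ ⟶ A), F.map α ≫ a = 0 → ∃ φ : G⟦i⟧ ⟶ B, φ ≫ b = α)
    (n : ℕ) (A : C) (a : F.obj A ⟶ t) (ha : ∀ i : ℤ, F.lifts a (G⟦i⟧)) :
    ∃ (A' : C) (a' : F.obj A' ⟶ t) (g : A ⟶ A'), F.map g ≫ a' = a ∧
      (ObjectProperty.singleton G).triangEnvelopeIter n ≤ F.kills a g ∧
      (ObjectProperty.singleton G).triangEnvelopeIter n ≤ F.lifts a' := by
  induction n generalizing A a with
  | zero =>
    obtain ⟨B, b, hb, hB⟩ := hker A a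
    -- The cone of `b` annihilates the kernel on shifts of `G`, while `a` still extends over it.
    obtain ⟨A', g, w, hT⟩ := distinguished_cocone_triangle b
    obtain ⟨a', ha'⟩ := F.exists_map_comp_eq₂ hT a hb
    have hbg : b ≫ g = 0 := comp_distTriang_mor_zero₁₂ _ hT
    refine ⟨A', a', g, ha', ?_, ?_⟩
    · refine ObjectProperty.singleton_triangEnvelopeIter_zero_le (fun i α hα => ?_)
        (fun X Y hX hY => F.kills_biprod hX hY)
      obtain ⟨φ, rfl⟩ := hB i α hα
      rw [Category.assoc, hbg, comp_zero]
    · exact ObjectProperty.singleton_triangEnvelopeIter_zero_le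
        (fun i => F.lifts_le_lifts g ha' _ (ha i)) (fun X Y hX hY => F.lifts_biprod hX hY)
  | succ n ih =>
    obtain ⟨A', a', f, hf, hk, hl⟩ := ih A a ha
    -- The first map handles the level-zero vertex of a triangle, the second the level-`n` vertex.
    obtain ⟨A'', a'', g, hg, hk', hl'⟩ := ih A' a' fun i => F.lifts_le_lifts f hf _ (ha i)
    have h₀ : (ObjectProperty.singleton G).triangEnvelopeIter 0 ≤
      (ObjectProperty.singleton G).triangEnvelopeIter n :=
      ObjectProperty.monotone'_triangEnvelopeIter _ n.zero_le
    refine ⟨A'', a'', f ≫ g, by rw [F.map_comp_assoc, hg, hf], ?_, ?_⟩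
    all_goals rw [ObjectProperty.triangEnvelopeIter_succ, ObjectProperty.retractClosure_le_iff,
      ← ObjectProperty.triangEnvelopeIter_zero]
    · exact F.extensionProduct_le_kills hf (h₀.trans hk) (h₀.trans hl) hk'
    · exact F.extensionProduct_le_lifts hg (h₀.trans hl) hk' hl'

lemma Functor.exists_bijective_of_kills_lifts (hC : IsIdempotentComplete C) {A A' : C}
    {a : F.obj A ⟶ t} {a' : F.obj A' ⟶ t} {g : A ⟶ A'} (hg : F.map g ≫ a' = a)
    (ha : F.lifts a = ⊤) (hk : F.kills a g = ⊤) :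
    ∃ (Z : C) (z : F.obj Z ⟶ t), ∀ X, Function.Bijective fun f : X ⟶ Z => F.map f ≫ z := by
  have hlift (X : C) : F.lifts a X := by rw [ha]; trivial
  have hkill (X : C) : F.kills a g X := by rw [hk]; trivial
  obtain ⟨s, hs⟩ := hlift _ a'
  -- Since `g ≫ s - 𝟙 A` lies in the kernel, `g` annihilates it; thus `s ≫ g` is idempotent.
  have hgsg : g ≫ s ≫ g = g := by
    have := hkill _ (g ≫ s - 𝟙 A) (by simp [hs, hg])
    simpa [sub_eq_zero] using this
  obtain ⟨Z, i, p, hip, hpi⟩ := hC.idempotents_split A' (s ≫ g) (by simp [hgsg])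
  refine ⟨Z, F.map i ≫ a', fun X => ⟨?_, fun x => ?_⟩⟩
  · intro f₁ f₂ h
    have h₀ : F.map ((f₁ - f₂) ≫ i) ≫ a' = 0 := by
      simpa [sub_eq_zero] using h
    have h₁ := hkill X (((f₁ - f₂) ≫ i) ≫ s) (by rw [F.map_comp_assoc, hs, h₀])
    rw [Category.assoc, ← hpi, Category.assoc, reassoc_of% hip] at h₁
    rw [← sub_eq_zero, ← Category.comp_id (f₁ - f₂), ← hip, reassoc_of% h₁, zero_comp]
  · obtain ⟨α, hα⟩ := hlift X x
    refine ⟨α ≫ g ≫ p, ?_⟩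
    dsimp only
    rw [← F.map_comp_assoc, Category.assoc, Category.assoc, hpi, hgsg, F.map_comp_assoc, hg, hα]

lemma Functor.isLeftAdjoint_of_bijective {A B : Type*} [Category* A] [Category* B] (F : A ⥤ B)
    (h : ∀ t : B, ∃ (Z : A) (z : F.obj Z ⟶ t),
      ∀ X, Function.Bijective fun f : X ⟶ Z => F.map f ≫ z) : F.IsLeftAdjoint := by
  have (t : B) : HasTerminal (CostructuredArrow F t) := by
    obtain ⟨Z, z, hz⟩ := h t
    have (X : CostructuredArrow F t) : Unique (X ⟶ CostructuredArrow.mk z) :=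
      { default := CostructuredArrow.homMk ((hz X.left).2 X.hom).choose
          ((hz X.left).2 X.hom).choose_spec
        uniq := fun f => by
          ext
          refine (hz X.left).1 ?_
          exact (CostructuredArrow.w f).trans ((hz X.left).2 X.hom).choose_spec.symm }
    exact hasTerminal_of_unique (CostructuredArrow.mk z)
  exact isLeftAdjoint_of_costructuredArrowTerminals F

variable (F) in
/-- A linear triangulated functor with Hom-finite source and target is a left adjoint if its source
is regular and idempotent complete. -/
theorem Functor.isLeftAdjoint_of_isRegularTriangulated (R : Type*) [CommRing R]
    [IsNoetherianRing R] [CategoryTheory.Linear R C] [CategoryTheory.Linear R D] [F.Linear R]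
    (hC : IsHomFinite R C) (hD : IsHomFinite R D) (hreg : IsRegularTriangulated C)
    (hkar : IsIdempotentComplete C) :
    F.IsLeftAdjoint := by
  refine F.isLeftAdjoint_of_bijective fun t => ?_
  obtain ⟨G, n, hn⟩ := hreg
  have hsupp : {i : ℤ | Nontrivial (F.obj (G⟦i⟧) ⟶ t)}.Finite := by
    refine (hD.finite_support (F.obj G) t).subset fun i hi => ?_
    exact (((F.commShiftIso i).app G).homCongr (Iso.refl t)).nontrivial_congr.1 hi
  obtain ⟨A₀, a₀, h₀, -⟩ := exists_factorization_of_family F (R := R) (fun i : ℤ => G⟦i⟧) (t := t)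
    (fun _ => ⊤) (fun i => (hD.finite _ _).fg_top) hsupp
  have hker (A : C) (a : F.obj A ⟶ t) : ∃ (B : C) (b : B ⟶ A), F.map b ≫ a = 0 ∧
      ∀ (i : ℤ) (α : G⟦i⟧ ⟶ A), F.map α ≫ a = 0 → ∃ φ : G⟦i⟧ ⟶ B, φ ≫ b = α := by
    have (i : ℤ) : Module.Finite R ((𝟭 C).obj (G⟦i⟧) ⟶ A) := hC.finite (G⟦i⟧) A
    obtain ⟨B, b, h₁, h₂⟩ := exists_factorization_of_family (𝟭 C) (R := R)
      (fun i : ℤ => G⟦i⟧) (t := A)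
      (fun i => LinearMap.ker (CategoryTheory.Linear.rightComp R _ a ∘ₗ F.mapLinearMap R))
      -- Noetherianity of `R` makes these kernels finitely generated.
      (fun i => IsNoetherian.noetherian _) (hC.finite_support G A)
    refine ⟨B, b, ?_, fun i α hα => h₁ i α hα⟩
    refine h₂ (AddMonoidHom.ker ((Preadditive.rightComp _ a).comp F.mapAddHom))
      fun i n (hn : F.map n ≫ a = 0) ψ => ?_
    change F.map (ψ ≫ n) ≫ a = 0
    rw [F.map_comp_assoc, hn, comp_zero]
  -- Two rounds: the first makes `a` lift every object, the second annihilates the kernel of this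
  -- new `a`.
  obtain ⟨A, a, -, -, -, hA⟩ := F.exists_triangEnvelopeIter_le_kills_lifts hker n A₀ a₀
    (fun i x => h₀ i x trivial)
  rw [hn, top_le_iff] at hA
  obtain ⟨A', a', g, hg, hk, -⟩ := F.exists_triangEnvelopeIter_le_kills_lifts hker n A a
    (fun i => by rw [hA]; trivial)
  rw [hn, top_le_iff] at hk
  exact F.exists_bijective_of_kills_lifts hkar hg hA hk

end Representability

open Pretriangulated.Opposite

/-! ### The dual theorem and regularity from an adjoint -/

section

variable {C D : Type*} [Category* C] [Category* D] [HasZeroObject C] [HasZeroObject D]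
  [HasShift C ℤ] [HasShift D ℤ] [Preadditive C] [Preadditive D]
  [∀ n : ℤ, (shiftFunctor C n).Additive] [∀ n : ℤ, (shiftFunctor D n).Additive]
  [Pretriangulated C] [Pretriangulated D] (F : C ⥤ D) [F.CommShift ℤ] [F.IsTriangulated]

/-- A linear triangulated functor with Hom-finite source and target is a right adjoint if its source
is regular and idempotent complete. -/
theorem Functor.isRightAdjoint_of_isRegularTriangulated [CategoryTheory.IsTriangulated C]
    (R : Type*) [CommRing R] [IsNoetherianRing R] [CategoryTheory.Linear R C]
    [CategoryTheory.Linear R D] [F.Linear R] (hC : IsHomFinite R C)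
    (hD : IsHomFinite R D) (hreg : IsRegularTriangulated C) (hkar : IsIdempotentComplete C) :
    F.IsRightAdjoint := by
  have := F.op.isLeftAdjoint_of_isRegularTriangulated R hC.op hD.op hreg.op inferInstance
  exact ⟨_, ⟨(Adjunction.ofIsLeftAdjoint F.op).unop⟩⟩

variable {F}

/-- Full faithfulness makes the counit invertible, so the left adjoint is essentially surjective. -/
lemma _root_.IsRegularTriangulated.of_isRightAdjoint_fullyFaithful [F.Full] [F.Faithful]
    [F.IsRightAdjoint] (h : IsRegularTriangulated D) : IsRegularTriangulated C := by
  let adj := Adjunction.ofIsRightAdjoint F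
  let _ := adj.leftAdjointCommShift ℤ
  have := adj.commShift_of_rightAdjoint ℤ
  have := adj.isTriangulated_leftAdjoint
  have : F.leftAdjoint.EssSurj := ⟨fun Y => ⟨F.obj Y, ⟨asIso (adj.counit.app Y)⟩⟩⟩
  exact h.of_essSurj F.leftAdjoint

lemma _root_.IsRegularTriangulated.of_isLeftAdjoint_fullyFaithful [F.Full] [F.Faithful]
    [F.IsLeftAdjoint] (h : IsRegularTriangulated D) : IsRegularTriangulated C := by
  let adj := Adjunction.ofIsLeftAdjoint F
  let _ := adj.rightAdjointCommShift ℤ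
  have := adj.commShift_of_leftAdjoint ℤ
  have := adj.isTriangulated_rightAdjoint
  have : F.rightAdjoint.EssSurj := ⟨fun X => ⟨F.obj X, ⟨(asIso (adj.unit.app X)).symm⟩⟩⟩
  exact h.of_essSurj F.rightAdjoint

end

end CategoryTheory

theorem corollary0p1p1p6
    (R : Type*) [CommRing R] [IsNoetherianRing R]
    (T : Type*) [Category* T] [HasZeroObject T] [HasShift T ℤ] [Preadditive T]
    [∀ n : ℤ, (shiftFunctor T n).Additive] [Pretriangulated T] [IsTriangulated T]
    [Linear R T]
    (hreg : IsRegularTriangulated T) (hkar : IsIdempotentComplete T) (hprop : IsProperOver R T)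
    (S : ObjectProperty T) [S.IsTriangulated]
    (hadj : S.ι.IsLeftAdjoint ∨ S.ι.IsRightAdjoint) :
    (S.ι.IsLeftAdjoint ∧ S.ι.IsRightAdjoint) ∧
      IsIdempotentComplete S.FullSubcategory ∧
      IsRegularTriangulated S.FullSubcategory ∧
      IsProperOver R S.FullSubcategory := by
  have hprop' : IsProperOver R S.FullSubcategory := .of_fullyFaithful S.ι hprop
  have hreg' : IsRegularTriangulated S.FullSubcategory := by
    obtain _ | _ := hadj
    · exact hreg.of_isLeftAdjoint_fullyFaithful (F := S.ι)
    · exact hreg.of_isRightAdjoint_fullyFaithful (F := S.ι)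
  have hkar' : IsIdempotentComplete S.FullSubcategory := by
    obtain _ | _ := hadj
    · exact isIdempotentComplete_of_comp_iso_id
        (asIso (Adjunction.ofIsLeftAdjoint S.ι).unit).symm hkar
    · exact isIdempotentComplete_of_comp_iso_id
        (asIso (Adjunction.ofIsRightAdjoint S.ι).counit) hkar
  exact ⟨⟨S.ι.isLeftAdjoint_of_isRegularTriangulated R hprop'.isHomFinite hprop.isHomFinite
      hreg' hkar',
    S.ι.isRightAdjoint_of_isRegularTriangulated R hprop'.isHomFinite hprop.isHomFinite
      hreg' hkar'⟩, hkar', hreg', hprop'⟩
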